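/- Let $A,B\in\mathbb{R}^{n\times n}$ be symmetric matrices. For a real square matrix $M$ write $N(M)=\{v : Mv=0\}$ and $Q(M)=\{v : v^TMv=0\}$; two symmetric matrices $A$, $B$ are simultaneously diagonalizable via congruence (SDC) if there is a nonsingular matrix $C$ such that both $C^TAC$ and $C^TBC$ are diagonal. Suppose that $$Q(A)\cap Q(B)=N(A)\cap N(B)\qquad\text{and}\qquad \dim\bigl(N(A)\cap N(B)\bigr)\le n-3 .$$ Then: (a') for every matrix $U$ whose columns form a basis of the orthogonal complement of $N(A)\cap N(B)$ in $\mathbb{R}^n$ (with respect to the standard inner product), there is a pair $(\mu,\sigma)\in\mathbb{R}^2$ such that $\mu\,U^TAU+\sigma\,U^TBU$ is positive definite; (b') there is a pair $(\mu,\sigma)\in\mathbb{R}^2$ with $(\mu,\sigma)\neq(0,0)$ such that $\mu A+\sigma B$ is positive semidefinite; and (c') $A$ and $B$ are simultaneously diagonalizable via congruence. -/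

import Mathlib

open Matrix

namespace MatrixPencil

variable {m n : Type*} [Fintype m] [Fintype n]

/-- The set `Q(A) = {v | vᵀ A v = 0}` of isotropic vectors of a real square matrix. -/
def isotropicSet (A : Matrix n n ℝ) : Set (n → ℝ) :=
  {v | v ⬝ᵥ (A *ᵥ v) = 0}

/-- The null space `N(A) = {v | A v = 0}`. -/
def nullSpace (A : Matrix n n ℝ) : Submodule ℝ (n → ℝ) :=
  LinearMap.ker A.mulVecLin

/-- `II_≻(A, B)`, the pairs `(μ, σ)` for which `μ A + σ B` is positive definite. -/
def posDefPairs (A B : Matrix n n ℝ) : Set (ℝ × ℝ) :=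
  {p | (p.1 • A + p.2 • B).PosDef}

/-- `II_⪰(A, B)`, the pairs `(μ, σ)` for which `μ A + σ B` is positive semidefinite. -/
def posSemidefPairs (A B : Matrix n n ℝ) : Set (ℝ × ℝ) :=
  {p | (p.1 • A + p.2 • B).PosSemidef}

/-- The orthogonal complement of a subspace of `ℝⁿ` for the standard inner product. -/
def orthComplement (S : Submodule ℝ (n → ℝ)) : Submodule ℝ (n → ℝ) :=
  S.orthogonalBilin (dotProductBilin ℝ ℝ)

/-- `U` is a basis matrix of `S`: its columns form a basis of `S`. -/
structure IsBasisMatrix (U : Matrix n m ℝ) (S : Submodule ℝ (n → ℝ)) : Prop where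
  linearIndependent : LinearIndependent ℝ U.col
  span_eq : Submodule.span ℝ (Set.range U.col) = S

/-- `A` and `B` are simultaneously diagonalizable via congruence. -/
def SDC [DecidableEq n] (A B : Matrix n n ℝ) : Prop :=
  ∃ C : Matrix n n ℝ, IsUnit C ∧ (Cᵀ * A * C).IsDiag ∧ (Cᵀ * B * C).IsDiag

end MatrixPencil

/-! On the orthogonal complement of the common kernel S, of dimension at least 3, the two forms have
no common nonzero isotropic vector. There the joint range of q(v) = (a(v,v), b(v,v)) over v ≠ 0 is
convex and misses the origin, so a linear functional positive on q of the unit sphere supplies (μ,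
σ): `exists_posDef_combination`. For convexity, `exists_joint_value_add` closes the range under
addition in any dimension; dimension 3 serves to exclude q(y) = -q(x) with x ≠ 0
(`eq_zero_of_opposite`), so that the vector obtained is nonzero. A positive definite combination
yields simultaneous diagonalization, and S is restored as a zero block. -/

namespace MatrixPencil
-- Convexity of the joint range of two quadratic forms
section Bilinear

variable {V : Type*} [AddCommGroup V] [Module ℝ V]

/-- The only common isotropic vector of two bilinear forms is zero. -/
def NoCommonZero (a b : LinearMap.BilinForm ℝ V) : Prop :=
  ∀ v, a v v = 0 → b v v = 0 → v = 0

/-- Here b vanishes on the span of x and y while a changes sign there, so a has an isotropic vector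
x + t y, which must be zero; then a(x,x) = t² a(y,y) ≤ 0. -/
theorem false_of_opposite_of_ortho {a b : LinearMap.BilinForm ℝ V} (ha : a.IsSymm) (hb : b.IsSymm)
    (h : NoCommonZero a b) {x y : V} (hx : b x x = 0) (hy : b y y = 0) (hxy : b x y = 0)
    (hax : 0 < a x x) (hay : a y y < 0) : False := by
  obtain ⟨t, ht⟩ := exists_quadratic_eq_zero (a := a y y) (b := 2 * a x y) (c := a x x) hay.ne
    ⟨√(discrim (a y y) (2 * a x y) (a x x)), (Real.mul_self_sqrt (by
      unfold discrim; nlinarith [sq_nonneg (a x y), mul_neg_of_pos_of_neg hax hay])).symm⟩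
  have hayx := ha.eq x y
  have hbyx := hb.eq x y
  have h0 : x + t • y = 0 := by
    refine h _ ?_ ?_
    · simp only [map_add, map_smul, LinearMap.add_apply, LinearMap.smul_apply, smul_eq_mul, ← hayx]
      linarith
    · simp [← hbyx, hx, hy, hxy]
  obtain rfl : x = -(t • y) := eq_neg_of_add_eq_zero_left h0
  simp at hax
  nlinarith [mul_self_nonneg t]

/-- The normalization of z makes the conic arc v(t) from x to y lie in the isotropic cone of b. By
the intermediate value theorem a vanishes somewhere on it, so v(t) = 0 there; pairing with z forces
t to be an endpoint, where a is nonzero. -/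
theorem false_of_opposite_of_conic {a b : LinearMap.BilinForm ℝ V} (hb : b.IsSymm)
    (h : NoCommonZero a b) {x y z : V} (hx : b x x = 0) (hy : b y y = 0) (hxz : b x z = 0)
    (hyz : b y z = 0) (hz : b z z ≠ 0) (hbz : b z z = -2 * b x y)
    (hax : 0 < a x x) (hay : a y y < 0) : False := by
  have hzx : b z x = 0 := by simpa using (hb.eq x z).symm.trans hxz
  have hzy : b z y = 0 := by simpa using (hb.eq y z).symm.trans hyz
  have hyx : b y x = b x y := by simpa using (hb.eq x y).symm
  set v : ℝ → V := fun t => (1 - t) ^ 2 • x + t ^ 2 • y + (t * (1 - t)) • z with hv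
  have hcont : Continuous fun t => a (v t) (v t) := by
    simp only [hv, map_add, map_smul, LinearMap.add_apply, LinearMap.smul_apply, smul_eq_mul]
    fun_prop
  obtain ⟨t, ht, hat⟩ : (0 : ℝ) ∈ (fun t => a (v t) (v t)) '' Set.Icc 0 1 :=
    intermediate_value_Icc' zero_le_one hcont.continuousOn (by simp [hv, hax.le, hay.le])
  have hvt : v t = 0 := by
    refine h _ hat ?_
    simp only [hv, map_add, map_smul, LinearMap.add_apply, LinearMap.smul_apply, smul_eq_mul,
      hx, hy, hxz, hyz, hzx, hzy, hyx, hbz]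
    ring
  have h1 : t * (1 - t) = 0 := by
    have := congrArg (b z) hvt
    simpa only [hv, map_add, map_smul, smul_eq_mul, hzx, hzy, mul_zero, zero_add, map_zero,
      mul_eq_zero, hz, or_false] using this
  rcases mul_eq_zero.mp h1 with h2 | h2
  · subst h2
    simp [hv] at hvt
    simp [hvt] at hax
  · obtain rfl : t = 1 := by linarith
    simp [hv] at hvt
    simp [hvt] at hay

theorem exists_ne_zero_of_two_functionals [FiniteDimensional ℝ V] (hV : 3 ≤ Module.finrank ℝ V)
    (f g : V →ₗ[ℝ] ℝ) : ∃ z ≠ 0, f z = 0 ∧ g z = 0 := by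
  have := (f.prod g).ker_ne_bot_of_finrank_lt (by simp; omega)
  obtain ⟨z, hz, hz0⟩ := Submodule.exists_mem_ne_zero_of_ne_bot this
  exact ⟨z, hz0, Prod.mk_eq_zero.mp hz⟩

theorem false_of_opposite [FiniteDimensional ℝ V] (hV : 3 ≤ Module.finrank ℝ V)
    {a b : LinearMap.BilinForm ℝ V} (ha : a.IsSymm) (hb : b.IsSymm)
    (h : NoCommonZero a b) {x y : V} (hx : b x x = 0) (hy : b y y = 0)
    (hax : 0 < a x x) (hay : a y y < 0) : False := by
  by_cases hxy : b x y = 0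
  · exact false_of_opposite_of_ortho ha hb h hx hy hxy hax hay
  -- The only use of dimension 3: a third direction b-orthogonal to both x and y.
  obtain ⟨z, hz0, hxz, hyz⟩ := exists_ne_zero_of_two_functionals hV (b x) (b y)
  by_cases hz : b z z = 0
  · have haz : a z z ≠ 0 := fun h' => hz0 (h z h' hz)
    rcases lt_or_gt_of_ne haz with h1 | h1
    · exact false_of_opposite_of_ortho ha hb h hx hz hxz hax h1
    · have hzy : b z y = 0 := by simpa using (hb.eq y z).symm.trans hyz
      exact false_of_opposite_of_ortho ha hb h hz hy hzy h1 hay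
  -- Rescaling z to fit the conic needs this ratio positive; replacing y by -y flips its sign.
  have key : ∀ y', b y' y' = 0 → b y' z = 0 → a y' y' < 0 → 0 < -2 * b x y' / b z z → False := by
    intro y' h1 h2 h3 h4
    refine false_of_opposite_of_conic (z := √(-2 * b x y' / b z z) • z) hb h hx h1
      (by simp [hxz]) (by simp [h2]) ?_ ?_ hax h3
    · simp only [map_smul, LinearMap.smul_apply, smul_eq_mul]
      have := (Real.sqrt_pos.mpr h4).ne'
      positivity
    · simp only [map_smul, LinearMap.smul_apply, smul_eq_mul]
      rw [← mul_assoc, Real.mul_self_sqrt h4.le, div_mul_cancel₀ _ hz]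
  have hne : -2 * b x y / b z z ≠ 0 := by simp [hxy, hz]
  rcases lt_or_gt_of_ne hne with h1 | h1
  · refine key (-y) (by simp [hy]) (by simp [hyz]) (by simpa using hay) ?_
    have : -2 * b x (-y) / b z z = -(-2 * b x y / b z z) := by simp; ring
    linarith
  · exact key y hy hyz hay h1

theorem eq_zero_of_opposite [FiniteDimensional ℝ V] (hV : 3 ≤ Module.finrank ℝ V)
    {a b : LinearMap.BilinForm ℝ V} (ha : a.IsSymm) (hb : b.IsSymm)
    (h : NoCommonZero a b) {x y : V} (hax : a y y = -a x x) (hbx : b y y = -b x x) : x = 0 := by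
  by_contra hx0
  have hpos : 0 < a x x * a x x + b x x * b x x := by
    by_contra hle
    have h1 : a x x = 0 := by nlinarith [mul_self_nonneg (a x x), mul_self_nonneg (b x x)]
    have h2 : b x x = 0 := by nlinarith [mul_self_nonneg (a x x), mul_self_nonneg (b x x)]
    exact hx0 (h x h1 h2)
  -- Rotate and scale the pencil so that the value at x falls on the positive first axis and that at
  -- y on the negative one.
  refine false_of_opposite hV (a := a x x • a + b x x • b) (b := a x x • b - b x x • a)
    (x := x) (y := y) ((ha.smul _).add (hb.smul _)) ((hb.smul _).sub (ha.smul _)) ?_ ?_ ?_ ?_ ?_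
  · intro v h1 h2
    simp only [LinearMap.add_apply, LinearMap.sub_apply, LinearMap.smul_apply, smul_eq_mul] at h1 h2
    refine h v ?_ ?_
    · refine (mul_eq_zero.mp ?_).resolve_left hpos.ne'
      linear_combination a x x * h1 - b x x * h2
    · refine (mul_eq_zero.mp ?_).resolve_left hpos.ne'
      linear_combination b x x * h1 + a x x * h2
  · simp; ring
  · simp [hax, hbx]; ring
  · simpa using hpos
  · simp only [LinearMap.add_apply, LinearMap.smul_apply, smul_eq_mul, hax, hbx]
    linarith

/-- Dines: the joint range of two quadratic forms is closed under addition. -/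
theorem exists_joint_value_add {a b : LinearMap.BilinForm ℝ V} (ha : a.IsSymm) (hb : b.IsSymm)
    (x y : V) : ∃ v, a v v = a x x + a y y ∧ b v v = b x x + b y y := by
  set s := a x x + a y y with hs
  set r := b x x + b y y with hr
  by_cases h0 : s = 0 ∧ r = 0
  · exact ⟨0, by simp [h0.1], by simp [h0.2]⟩
  have hpos : 0 < s * s + r * r := by
    by_contra hle
    exact h0 ⟨by nlinarith [mul_self_nonneg s, mul_self_nonneg r],
      by nlinarith [mul_self_nonneg s, mul_self_nonneg r]⟩
  have hayx : a y x = a x y := by simpa using (ha.eq x y).symm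
  have hbyx : b y x = b x y := by simpa using (hb.eq x y).symm
  set p := r * a x x - s * b x x with hp
  -- The form ℓ = r a - s b has ℓ(y) = -ℓ(x) = -p, so this one quadratic in t, with discriminant ≥
  -- 0, puts both x + t y and t x - y on ℓ = 0.
  obtain ⟨t, ht⟩ : ∃ t : ℝ, p + 2 * (r * a x y - s * b x y) * t - p * t ^ 2 = 0 := by
    by_cases hp0 : p = 0
    · exact ⟨0, by simp [hp0]⟩
    set q := 2 * (r * a x y - s * b x y)
    obtain ⟨t, ht⟩ := exists_quadratic_eq_zero (a := -p) (b := q) (c := p) (neg_ne_zero.mpr hp0)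
      ⟨√(discrim (-p) q p), (Real.mul_self_sqrt (by
        unfold discrim; nlinarith [sq_nonneg q, sq_nonneg p])).symm⟩
    exact ⟨t, by linarith⟩
  have key : ∀ v, r * a v v - s * b v v = 0 → 0 < s * a v v + r * b v v →
      ∃ v, a v v = s ∧ b v v = r := by
    intro v h1 h2
    set c := (s * s + r * r) / (s * a v v + r * b v v) with hc
    have hc0 : 0 < c := div_pos hpos h2
    have hcm : c * (s * a v v + r * b v v) = s * s + r * r := div_mul_cancel₀ _ h2.ne'
    refine ⟨√c • v, ?_, ?_⟩
    · simp only [map_smul, LinearMap.smul_apply, smul_eq_mul]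
      rw [← mul_assoc, Real.mul_self_sqrt hc0.le]
      refine mul_left_cancel₀ hpos.ne' ?_
      linear_combination s * hcm + r * c * h1
    · simp only [map_smul, LinearMap.smul_apply, smul_eq_mul]
      rw [← mul_assoc, Real.mul_self_sqrt hc0.le]
      refine mul_left_cancel₀ hpos.ne' ?_
      linear_combination r * hcm - s * c * h1
  have h1 : r * a (x + t • y) (x + t • y) - s * b (x + t • y) (x + t • y) = 0 := by
    simp only [map_add, map_smul, LinearMap.add_apply, LinearMap.smul_apply, smul_eq_mul,
      hayx, hbyx]
    linear_combination ht - t ^ 2 * r * hs + t ^ 2 * s * hr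
  have h2 : r * a (t • x - y) (t • x - y) - s * b (t • x - y) (t • x - y) = 0 := by
    simp only [map_sub, map_smul, LinearMap.sub_apply, LinearMap.smul_apply, smul_eq_mul,
      hayx, hbyx]
    linear_combination -ht - r * hs + s * hr
  have h3 : (s * a (x + t • y) (x + t • y) + r * b (x + t • y) (x + t • y)) +
      (s * a (t • x - y) (t • x - y) + r * b (t • x - y) (t • x - y)) =
        (1 + t ^ 2) * (s * s + r * r) := by
    simp only [map_add, map_sub, map_smul, LinearMap.add_apply, LinearMap.sub_apply,
      LinearMap.smul_apply, smul_eq_mul, hayx, hbyx]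
    linear_combination -(1 + t ^ 2) * s * hs - (1 + t ^ 2) * r * hr
  -- The components along (s, r) have positive sum, so one of the two vectors has value a positive
  -- multiple of (s, r), and scaling finishes.
  by_cases h4 : 0 < s * a (x + t • y) (x + t • y) + r * b (x + t • y) (x + t • y)
  · exact key _ h1 h4
  · refine key _ h2 ?_
    have : 0 < (1 + t ^ 2) * (s * s + r * r) := by positivity
    linarith

theorem convex_joint_range [FiniteDimensional ℝ V] (hV : 3 ≤ Module.finrank ℝ V)
    {a b : LinearMap.BilinForm ℝ V} (ha : a.IsSymm) (hb : b.IsSymm) (h : NoCommonZero a b) :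
    Convex ℝ ((fun v : V => (a v v, b v v)) '' {v | v ≠ 0}) := by
  rintro _ ⟨x, hx, rfl⟩ _ ⟨y, hy, rfl⟩ α β hα hβ hαβ
  obtain ⟨v, hv1, hv2⟩ := exists_joint_value_add ha hb (√α • x) (√β • y)
  simp only [map_smul, LinearMap.smul_apply, smul_eq_mul, ← mul_assoc,
    Real.mul_self_sqrt hα, Real.mul_self_sqrt hβ] at hv1 hv2
  refine ⟨v, ?_, by simp [hv1, hv2]⟩
  rintro rfl
  simp only [map_zero] at hv1 hv2
  have h1 : √α • x = 0 := eq_zero_of_opposite hV ha hb h (y := √β • y)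
    (by simp only [map_smul, LinearMap.smul_apply, smul_eq_mul, ← mul_assoc,
          Real.mul_self_sqrt hα, Real.mul_self_sqrt hβ]; linarith)
    (by simp only [map_smul, LinearMap.smul_apply, smul_eq_mul, ← mul_assoc,
          Real.mul_self_sqrt hα, Real.mul_self_sqrt hβ]; linarith)
  have hα0 : α = 0 := (Real.sqrt_eq_zero hα).mp ((smul_eq_zero.mp h1).resolve_right hx)
  obtain rfl : β = 1 := by linarith
  subst hα0
  exact hy (h y (by linarith) (by linarith))

end Bilinear
end MatrixPencil
namespace MatrixPencil
-- Compactness of convex hulls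
section CompactHull

/-- Carathéodory bounds the number of points by dim + 1; padding with zero weights at `z₀` makes the
hull a continuous image of simplex × K^d. -/
theorem isCompact_convexHull_of_finiteDimensional {E : Type*} [NormedAddCommGroup E]
    [NormedSpace ℝ E] [FiniteDimensional ℝ E] {K : Set E} (hK : IsCompact K) :
    IsCompact (convexHull ℝ K) := by
  rcases K.eq_empty_or_nonempty with rfl | ⟨z₀, hz₀⟩
  · simp
  set d := Module.finrank ℝ E + 1
  set F : (Fin d → ℝ) × (Fin d → E) → E := fun p => ∑ i, p.1 i • p.2 i
  have hF : Continuous F := by fun_prop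
  have hS : IsCompact (stdSimplex ℝ (Fin d) ×ˢ Set.univ.pi fun _ : Fin d => K) :=
    (isCompact_stdSimplex ℝ (Fin d)).prod (isCompact_univ_pi fun _ => hK)
  suffices h : convexHull ℝ K = F '' (stdSimplex ℝ (Fin d) ×ˢ Set.univ.pi fun _ : Fin d => K) from
    h ▸ hS.image hF
  refine Set.Subset.antisymm (fun x hx => ?_) ?_
  · obtain ⟨ι, _, z, w, hz, hind, hw, hw1, hsum⟩ := eq_pos_convex_span_of_mem_convexHull hx
    obtain ⟨e⟩ : Nonempty (ι ↪ Fin d) := Function.Embedding.nonempty_of_card_le (by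
      rw [Fintype.card_fin]
      exact hind.card_le_finrank_succ.trans
        (Nat.add_le_add_right (Submodule.finrank_le _) 1))
    have hext : ∀ i, i ∉ Set.range e → Function.extend e w 0 i = 0 := fun i hi =>
      Function.extend_apply' _ _ _ hi
    refine ⟨(Function.extend e w 0, Function.extend e z fun _ => z₀), ⟨⟨fun i => ?_, ?_⟩, ?_⟩, ?_⟩
    · by_cases hi : i ∈ Set.range e
      · obtain ⟨j, rfl⟩ := hi
        simpa [e.injective.extend_apply] using (hw j).le
      · simp [hext i hi]
    · rw [← hw1]
      exact (Fintype.sum_of_injective e e.injective _ _ hext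
        fun i => by simp [e.injective.extend_apply]).symm
    · intro i _
      by_cases hi : i ∈ Set.range e
      · obtain ⟨j, rfl⟩ := hi
        simpa [e.injective.extend_apply] using hz ⟨j, rfl⟩
      · simpa [Function.extend_apply' _ _ _ hi] using hz₀
    · rw [← hsum]
      exact (Fintype.sum_of_injective e e.injective _ _ (fun i hi => by simp [hext i hi])
        fun i => by simp [e.injective.extend_apply]).symm
  · rintro _ ⟨⟨w, z⟩, ⟨hw, hz⟩, rfl⟩
    exact (convex_convexHull ℝ K).sum_mem (fun i _ => hw.1 i) hw.2
      fun i _ => subset_convexHull ℝ K (hz i trivial)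

end CompactHull

/-! ### Separation and definite combinations -/

section Calabi
variable {m : Type*} [Fintype m]

/-- Calabi: two symmetric matrices of size at least three without nontrivial common isotropic
vector have a positive definite linear combination. -/
theorem exists_posDef_combination (hm : 3 ≤ Fintype.card m) {A B : Matrix m m ℝ} (hA : A.IsSymm)
    (hB : B.IsSymm) (h : ∀ v, v ⬝ᵥ (A *ᵥ v) = 0 → v ⬝ᵥ (B *ᵥ v) = 0 → v = 0) :
    ∃ μ σ : ℝ, (μ • A + σ • B).PosDef := by
  classical
  have happ : ∀ (M : Matrix m m ℝ) v, M.toBilin' v v = v ⬝ᵥ (M *ᵥ v) := fun M v =>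
    Matrix.toBilin'_apply' M v v
  have hsymm : ∀ {M : Matrix m m ℝ}, M.IsSymm → M.toBilin'.IsSymm := fun {M} hM =>
    ⟨fun x y => by
      simp only [Matrix.toBilin'_apply']
      rw [dotProduct_mulVec, ← mulVec_transpose, hM.eq, dotProduct_comm]⟩
  have hconv := convex_joint_range (V := m → ℝ) (by simpa using hm) (hsymm hA) (hsymm hB)
    (fun v => by rw [happ, happ]; exact h v)
  simp only [happ] at hconv
  set q : (m → ℝ) → ℝ × ℝ := fun v => (v ⬝ᵥ (A *ᵥ v), v ⬝ᵥ (B *ᵥ v))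
  have hq : Continuous q := by fun_prop
  have hsub : convexHull ℝ (q '' Metric.sphere 0 1) ⊆ q '' {v | v ≠ 0} :=
    convexHull_min (Set.image_mono fun v hv => ne_zero_of_mem_unit_sphere ⟨v, hv⟩) hconv
  have h0 : (0 : ℝ × ℝ) ∉ convexHull ℝ (q '' Metric.sphere 0 1) := fun hmem => by
    obtain ⟨v, hv, hv0⟩ := hsub hmem
    exact hv (h v (congrArg Prod.fst hv0) (congrArg Prod.snd hv0))
  obtain ⟨f, u, hu, hf⟩ := geometric_hahn_banach_point_closed (convex_convexHull ℝ _)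
    (isCompact_convexHull_of_finiteDimensional ((isCompact_sphere 0 1).image hq)).isClosed h0
  rw [map_zero] at hu
  refine ⟨f (1, 0), f (0, 1), PosDef.of_dotProduct_mulVec_pos ?_ fun x hx => ?_⟩
  · simp [IsHermitian, conjTranspose_eq_transpose_of_trivial, hA.eq, hB.eq]
  · have hfq : ∀ v, f (q v) = v ⬝ᵥ ((f (1, 0) • A + f (0, 1) • B) *ᵥ v) := fun v => by
      have : q v = (v ⬝ᵥ (A *ᵥ v)) • ((1, 0) : ℝ × ℝ) + (v ⬝ᵥ (B *ᵥ v)) • ((0, 1) : ℝ × ℝ) := by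
        simp [q]
      rw [this, map_add, map_smul, map_smul]
      simp [add_mulVec, smul_mulVec, dotProduct_add, mul_comm]
    have hx' : 0 < ‖x‖ := norm_pos_iff.mpr hx
    have h1 := hu.trans (hf _ (subset_convexHull ℝ _ ⟨‖x‖⁻¹ • x, by
      simp [norm_smul, hx'.ne'], rfl⟩))
    rw [hfq, mulVec_smul, smul_dotProduct, dotProduct_smul, smul_eq_mul, smul_eq_mul,
      ← mul_assoc] at h1
    simpa using pos_of_mul_pos_right h1 (by positivity)

end Calabi

/-! ### Simultaneous diagonalization -/

section Diagonalization
variable {m : Type*} [Fintype m] [DecidableEq m]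

theorem exists_orthogonal_diagonalization {S : Matrix m m ℝ} (hS : S.IsSymm) :
    ∃ V : Matrix m m ℝ, Vᵀ * V = 1 ∧ ∃ d : m → ℝ, Vᵀ * S * V = diagonal d ∧
      (S.PosDef → ∀ i, 0 < d i) := by
  have hH : S.IsHermitian := by
    rw [IsHermitian, conjTranspose_eq_transpose_of_trivial, hS.eq]
  refine ⟨hH.eigenvectorUnitary, ?_, hH.eigenvalues, ?_, fun hP => hP.eigenvalues_pos⟩
  · simpa [star_eq_conjTranspose] using Unitary.coe_star_mul_self hH.eigenvectorUnitary
  · simpa [Unitary.conjStarAlgAut_star_apply, star_eq_conjTranspose, Function.comp_def]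
      using hH.conjStarAlgAut_star_eigenvectorUnitary

/-- Whiten P to the identity, then diagonalize the transformed S by an orthogonal matrix, which
preserves the identity. -/
theorem exists_congr_one_diagonal {P S : Matrix m m ℝ} (hP : P.PosDef) (hS : S.IsSymm) :
    ∃ C : Matrix m m ℝ, IsUnit C ∧ Cᵀ * P * C = 1 ∧ (Cᵀ * S * C).IsDiag := by
  have hPs : P.IsSymm := by
    simpa [IsHermitian, IsSymm, conjTranspose_eq_transpose_of_trivial] using hP.isHermitian
  obtain ⟨V, hV, d, hd, hpos⟩ := exists_orthogonal_diagonalization hPs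
  specialize hpos hP
  set E : Matrix m m ℝ := diagonal fun i => (√(d i))⁻¹
  have hC₁ : (V * E)ᵀ * P * (V * E) = 1 := by
    have : (V * E)ᵀ * P * (V * E) = E * (Vᵀ * P * V) * E := by
      simp [E, transpose_mul, Matrix.mul_assoc]
    rw [this, hd]
    simp only [E, diagonal_mul_diagonal]
    rw [← diagonal_one]
    congr 1
    funext i
    have h1 := Real.mul_self_sqrt (hpos i).le
    have h2 := (Real.sqrt_pos.mpr (hpos i)).ne'
    field_simp
    linarith
  obtain ⟨W, hW, e, he, -⟩ := exists_orthogonal_diagonalization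
    (S := (V * E)ᵀ * S * (V * E)) (by simp [IsSymm, transpose_mul, hS.eq, Matrix.mul_assoc])
  have hC : (V * E * W)ᵀ * P * (V * E * W) = 1 := by
    have : (V * E * W)ᵀ * P * (V * E * W) = Wᵀ * ((V * E)ᵀ * P * (V * E)) * W := by
      simp only [transpose_mul, Matrix.mul_assoc]
    rw [this, hC₁, Matrix.mul_one, hW]
  refine ⟨V * E * W, IsUnit.of_mul_eq_one_right _ hC, hC, ?_⟩
  have : (V * E * W)ᵀ * S * (V * E * W) = Wᵀ * ((V * E)ᵀ * S * (V * E)) * W := by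
    simp only [transpose_mul, Matrix.mul_assoc]
  rw [this, he]
  exact isDiag_diagonal e

theorem sdc_of_posDef_combination {A B : Matrix m m ℝ} (hA : A.IsSymm) (hB : B.IsSymm)
    {μ σ : ℝ} (hP : (μ • A + σ • B).PosDef) (h0 : (μ, σ) ≠ (0, 0)) :
    ∃ C : Matrix m m ℝ, IsUnit C ∧ (Cᵀ * A * C).IsDiag ∧ (Cᵀ * B * C).IsDiag := by
  -- A and B are recovered from μA + σB and μB - σA, a change of pencil basis with determinant μ² +
  -- σ².
  obtain ⟨C, hC, h1, h2⟩ := exists_congr_one_diagonal (S := μ • B - σ • A) hP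
    ((hB.smul μ).sub (hA.smul σ))
  have hr : μ * μ + σ * σ ≠ 0 := fun h => h0 <| by
    ext
    · simp only; nlinarith [mul_self_nonneg μ, mul_self_nonneg σ]
    · simp only; nlinarith [mul_self_nonneg μ, mul_self_nonneg σ]
  have hd1 : (Cᵀ * (μ • A + σ • B) * C).IsDiag := h1 ▸ isDiag_one
  refine ⟨C, hC, ?_, ?_⟩
  · have : Cᵀ * A * C = (μ * μ + σ * σ)⁻¹ • (μ • (Cᵀ * (μ • A + σ • B) * C) -
        σ • (Cᵀ * (μ • B - σ • A) * C)) := by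
      rw [eq_inv_smul_iff₀ hr]
      simp only [Matrix.mul_add, Matrix.mul_sub, Matrix.add_mul, Matrix.sub_mul, Matrix.mul_smul,
        Matrix.smul_mul]
      module
    rw [this]
    exact ((hd1.smul μ).sub (h2.smul σ)).smul _
  · have : Cᵀ * B * C = (μ * μ + σ * σ)⁻¹ • (σ • (Cᵀ * (μ • A + σ • B) * C) +
        μ • (Cᵀ * (μ • B - σ • A) * C)) := by
      rw [eq_inv_smul_iff₀ hr]
      simp only [Matrix.mul_add, Matrix.mul_sub, Matrix.add_mul, Matrix.sub_mul, Matrix.mul_smul,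
        Matrix.smul_mul]
      module
    rw [this]
    exact ((hd1.smul σ).add (h2.smul μ)).smul _

end Diagonalization
end MatrixPencil
namespace MatrixPencil
-- Passing to the complement of the common kernel
section Reduction

variable {n : ℕ}

theorem isCompl_orthComplement (S : Submodule ℝ (Fin n → ℝ)) : IsCompl S (orthComplement S) := by
  have hrefl : LinearMap.IsRefl (dotProductBilin ℝ ℝ : LinearMap.BilinForm ℝ (Fin n → ℝ)) :=
    fun x y h => (dotProduct_comm y x).trans h
  refine (LinearMap.BilinForm.isCompl_orthogonal_iff_disjoint hrefl).mpr ?_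
  rw [Submodule.disjoint_def]
  exact fun x hx hx' => dotProduct_self_eq_zero.mp (hx' x hx)

theorem exists_isBasisMatrix (S : Submodule ℝ (Fin n → ℝ)) :
    ∃ U : Matrix (Fin n) (Fin (Module.finrank ℝ S)) ℝ, IsBasisMatrix U S := by
  have b := Module.finBasis ℝ S
  refine ⟨(of fun j => (b j : Fin n → ℝ))ᵀ, ?_, ?_⟩
  · exact b.linearIndependent.map' S.subtype S.ker_subtype
  · have := congrArg (Submodule.map S.subtype) b.span_eq
    rwa [Submodule.map_span, ← Set.range_comp, Submodule.map_top, Submodule.range_subtype] at this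

namespace IsBasisMatrix

variable {k : ℕ} {U : Matrix (Fin n) (Fin k) ℝ} {S : Submodule ℝ (Fin n → ℝ)}

theorem mem_iff (hU : IsBasisMatrix U S) {v : Fin n → ℝ} : v ∈ S ↔ ∃ w, U *ᵥ w = v := by
  rw [← hU.span_eq, ← range_mulVecLin]
  rfl

theorem mulVec_mem (hU : IsBasisMatrix U S) (w : Fin k → ℝ) : U *ᵥ w ∈ S := hU.mem_iff.mpr ⟨w, rfl⟩

theorem mulVec_injective (hU : IsBasisMatrix U S) : Function.Injective U.mulVec :=
  mulVec_injective_iff.mpr hU.linearIndependent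

theorem finrank_eq (hU : IsBasisMatrix U S) : Module.finrank ℝ S = k := by
  rw [← hU.span_eq, finrank_span_eq_card hU.linearIndependent, Fintype.card_fin]

end IsBasisMatrix

theorem isSymm_transpose_mul_mul {m k : Type*} [Fintype m] {M : Matrix m m ℝ} (hM : M.IsSymm)
    (U : Matrix m k ℝ) : (Uᵀ * M * U).IsSymm := by
  simp [IsSymm, transpose_mul, hM.eq, Matrix.mul_assoc]

theorem dotProduct_transpose_mul_mul {m k : Type*} [Fintype m] [Fintype k] (M : Matrix m m ℝ)
    (U : Matrix m k ℝ) (w : k → ℝ) :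
    w ⬝ᵥ ((Uᵀ * M * U) *ᵥ w) = (U *ᵥ w) ⬝ᵥ (M *ᵥ (U *ᵥ w)) := by
  rw [← mulVec_mulVec, ← mulVec_mulVec, dotProduct_mulVec, vecMul_transpose]

theorem posSemidef_of_posDef_restriction {k : ℕ} {M : Matrix (Fin n) (Fin n) ℝ} (hM : M.IsSymm)
    {S : Submodule ℝ (Fin n → ℝ)} (hS : S ≤ nullSpace M) {U : Matrix (Fin n) (Fin k) ℝ}
    (hU : IsBasisMatrix U (orthComplement S)) (hP : (Uᵀ * M * U).PosDef) : M.PosSemidef := by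
  refine PosSemidef.of_dotProduct_mulVec_nonneg ?_ fun v => ?_
  · rw [IsHermitian, conjTranspose_eq_transpose_of_trivial, hM.eq]
  · obtain ⟨v₀, hv₀, v₁, hv₁, rfl⟩ := Submodule.mem_sup.mp
      ((isCompl_orthComplement S).sup_eq_top ▸ Submodule.mem_top (x := v))
    obtain ⟨w, rfl⟩ := hU.mem_iff.mp hv₁
    have h0 : M *ᵥ v₀ = 0 := hS hv₀
    have h1 : v₀ ⬝ᵥ (M *ᵥ (U *ᵥ w)) = 0 := by
      rw [dotProduct_mulVec, ← mulVec_transpose, hM.eq, h0, zero_dotProduct]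
    have := hP.posSemidef.dotProduct_mulVec_nonneg w
    rw [star_trivial, dotProduct_transpose_mul_mul] at this
    rwa [star_trivial, mulVec_add, h0, zero_add, add_dotProduct, h1, zero_add]

theorem transpose_fromCols_mul_fromCols {k l : Type*} [Fintype k] [Fintype l]
    {M : Matrix (Fin n) (Fin n) ℝ} (hM : M.IsSymm) (W : Matrix (Fin n) k ℝ)
    {Z : Matrix (Fin n) l ℝ} (hZ : M * Z = 0) :
    (fromCols W Z)ᵀ * M * fromCols W Z = fromBlocks (Wᵀ * M * W) 0 0 0 := by
  have hZ' : Zᵀ * M = 0 := by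
    rw [← transpose_eq_zero, transpose_mul, transpose_transpose, hM.eq, hZ]
  rw [transpose_fromCols, fromRows_mul, fromRows_mul_fromCols, hZ', Matrix.mul_assoc Wᵀ M Z, hZ]
  simp

/-- Appending a basis Z of S to the columns of U C gives an invertible matrix; since A and B kill Z,
both congruences are diagonal blocks padded by zero. -/
theorem sdc_of_restriction {A B : Matrix (Fin n) (Fin n) ℝ} (hA : A.IsSymm) (hB : B.IsSymm)
    {S : Submodule ℝ (Fin n → ℝ)} (hSA : S ≤ nullSpace A) (hSB : S ≤ nullSpace B) {k : ℕ}
    {U : Matrix (Fin n) (Fin k) ℝ} (hU : IsBasisMatrix U (orthComplement S))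
    (h : SDC (Uᵀ * A * U) (Uᵀ * B * U)) : SDC A B := by
  obtain ⟨C, hC, hCA, hCB⟩ := h
  obtain ⟨Z, hZ⟩ := exists_isBasisMatrix S
  have hcompl := isCompl_orthComplement S
  have hcard : Module.finrank ℝ S + k = n := by
    rw [← hU.finrank_eq, Submodule.finrank_add_eq_of_isCompl hcompl, Module.finrank_fin_fun]
  let e : Fin k ⊕ Fin (Module.finrank ℝ S) ≃ Fin n :=
    finSumFinEquiv.trans (finCongr (by omega))
  set W := fromCols (U * C) Z
  have hinj : Function.Injective W.mulVec := by
    refine (injective_iff_map_eq_zero W.mulVecLin).mpr fun x hx => ?_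
    rw [mulVecLin_apply, fromCols_mulVec, ← mulVec_mulVec] at hx
    have hmem : U *ᵥ (C *ᵥ (x ∘ Sum.inl)) ∈ S := by
      rw [eq_neg_of_add_eq_zero_left hx]
      exact S.neg_mem (hZ.mulVec_mem _)
    have h1 := Submodule.disjoint_def.mp hcompl.disjoint _ hmem (hU.mulVec_mem _)
    rw [h1, zero_add] at hx
    have h2 : x ∘ Sum.inr = 0 := hZ.mulVec_injective (hx.trans (mulVec_zero Z).symm)
    have h3 : x ∘ Sum.inl = 0 := mulVec_injective_of_isUnit hC
      ((hU.mulVec_injective (h1.trans (mulVec_zero U).symm)).trans (mulVec_zero C).symm)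
    ext (i | i)
    · exact congrFun h3 i
    · exact congrFun h2 i
  have hdiag : ∀ M : Matrix (Fin n) (Fin n) ℝ, M.IsSymm → S ≤ nullSpace M →
      (Cᵀ * (Uᵀ * M * U) * C).IsDiag →
      ((W.submatrix id e.symm)ᵀ * M * W.submatrix id e.symm).IsDiag := by
    intro M hM hSM hd
    have hMZ : M * Z = 0 := by
      refine ext_of_mulVec_single fun i => ?_
      rw [← mulVec_mulVec, zero_mulVec]
      exact hSM (hZ.mulVec_mem _)
    have : (W.submatrix id e.symm)ᵀ * M * W.submatrix id e.symm =
        (Wᵀ * M * W).submatrix e.symm e.symm := rfl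
    rw [this, transpose_fromCols_mul_fromCols hM _ hMZ]
    refine IsDiag.submatrix (IsDiag.fromBlocks ?_ (fun _ _ _ => rfl)) e.symm.injective
    rwa [transpose_mul, show Cᵀ * Uᵀ * M * (U * C) = Cᵀ * (Uᵀ * M * U) * C by
      simp only [Matrix.mul_assoc]]
  refine ⟨W.submatrix id e.symm, mulVec_injective_iff_isUnit.mp ?_, hdiag A hA hSA hCA,
    hdiag B hB hSB hCB⟩
  intro x y hxy
  simp only [submatrix_mulVec_equiv, Equiv.symm_symm, Function.comp_id] at hxy
  exact e.surjective.injective_comp_right (hinj hxy)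

end Reduction
end MatrixPencil

theorem mainTheorem5 {n : ℕ} (A B : Matrix (Fin n) (Fin n) ℝ)
    (hA : A.IsSymm) (hB : B.IsSymm)
    (hQ : MatrixPencil.isotropicSet A ∩ MatrixPencil.isotropicSet B =
      ((MatrixPencil.nullSpace A ⊓ MatrixPencil.nullSpace B :
        Submodule ℝ (Fin n → ℝ)) : Set (Fin n → ℝ)))
    (hdim : (Module.finrank ℝ
      (MatrixPencil.nullSpace A ⊓ MatrixPencil.nullSpace B :
        Submodule ℝ (Fin n → ℝ)) : ℤ) ≤ (n : ℤ) - 3) :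
    (∀ (k : ℕ) (U : Matrix (Fin n) (Fin k) ℝ),
      MatrixPencil.IsBasisMatrix U
        (MatrixPencil.orthComplement
          (MatrixPencil.nullSpace A ⊓ MatrixPencil.nullSpace B)) →
      (MatrixPencil.posDefPairs (Uᵀ * A * U) (Uᵀ * B * U)).Nonempty) ∧
    (∃ p ∈ MatrixPencil.posSemidefPairs A B, p ≠ (0, 0)) ∧
    MatrixPencil.SDC A B := by
  open MatrixPencil in
  set S := nullSpace A ⊓ nullSpace B with hS
  have hcompl := isCompl_orthComplement S
  have hk : ∀ {k : ℕ} {U : Matrix (Fin n) (Fin k) ℝ}, IsBasisMatrix U (orthComplement S) →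
      3 ≤ k := fun {k U} hU => by
    have := Submodule.finrank_add_eq_of_isCompl hcompl
    rw [hU.finrank_eq, Module.finrank_fin_fun] at this
    omega
  have ha : ∀ (k : ℕ) (U : Matrix (Fin n) (Fin k) ℝ), IsBasisMatrix U (orthComplement S) →
      (posDefPairs (Uᵀ * A * U) (Uᵀ * B * U)).Nonempty := by
    intro k U hU
    obtain ⟨μ, σ, h⟩ := exists_posDef_combination (by simpa using hk hU)
      (isSymm_transpose_mul_mul hA U) (isSymm_transpose_mul_mul hB U) (fun w h1 h2 => by
        rw [dotProduct_transpose_mul_mul] at h1 h2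
        have hmem : U *ᵥ w ∈ S := by
          have : U *ᵥ w ∈ (S : Set (Fin n → ℝ)) := hQ ▸ ⟨h1, h2⟩
          exact this
        have h0 := Submodule.disjoint_def.mp hcompl.disjoint _ hmem (hU.mulVec_mem w)
        exact hU.mulVec_injective (h0.trans (mulVec_zero U).symm))
    exact ⟨(μ, σ), h⟩
  obtain ⟨U, hU⟩ := exists_isBasisMatrix (orthComplement S)
  obtain ⟨⟨μ, σ⟩, hP⟩ := ha _ U hU
  have hP : (μ • (Uᵀ * A * U) + σ • (Uᵀ * B * U)).PosDef := hP
  -- As k ≥ 3, the matrix has a diagonal entry, which must be positive.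
  have h0 : (μ, σ) ≠ (0, 0) := fun h => by
    obtain ⟨rfl, rfl⟩ := Prod.mk.inj h
    have := hP.diag_pos (i := ⟨0, by have := hk hU; omega⟩)
    simp at this
  refine ⟨ha, ⟨(μ, σ), ?_, h0⟩, ?_⟩
  · refine posSemidef_of_posDef_restriction ((hA.smul μ).add (hB.smul σ)) (S := S) ?_ hU ?_
    · intro v hv
      have h1 : A *ᵥ v = 0 := hv.1
      have h2 : B *ᵥ v = 0 := hv.2
      change (μ • A + σ • B) *ᵥ v = 0
      rw [add_mulVec, smul_mulVec, smul_mulVec, h1, h2, smul_zero, smul_zero, add_zero]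
    · have : Uᵀ * (μ • A + σ • B) * U = μ • (Uᵀ * A * U) + σ • (Uᵀ * B * U) := by
        simp [Matrix.mul_add, Matrix.add_mul]
      rwa [this]
  · exact sdc_of_restriction hA hB inf_le_left inf_le_right hU
      (sdc_of_posDef_combination (isSymm_transpose_mul_mul hA U) (isSymm_transpose_mul_mul hB U)
        hP h0)
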